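/- On $\mathbb R^4$ with standard coordinates $(x_1,x_2,x_3,x_4)$ consider the frame $$F_1=\partial_1,\quad F_2=\partial_2,\quad F_3=\partial_3,\quad F_4=x_1\partial_2+x_2\partial_3+\partial_4$$ and its dual coframe $\varphi^1=dx_1$, $\varphi^2=dx_2-x_1dx_4$, $\varphi^3=dx_3-x_2dx_4$, $\varphi^4=dx_4$. Let $g=\sum_{a}\varphi^a\otimes\varphi^a$ be the $\mathrm{nil}^4$ metric, with Levi-Civita connection $\nabla$, curvature $R$ (with $R_{ijji}$ the sectional curvatures in an orthonormal frame), Ricci tensor $\mathrm{Rc}$ and Riemannian measure $\mu$, and let $$X_0=-x_1\partial_1-\tfrac32x_2\partial_2-2x_3\partial_3-\tfrac12x_4\partial_4 .$$ For a vector field $X$ and a symmetric covariant $2$-tensor field $h$ put $$Lh=\Delta_\ell h-\mathcal L_Xh-3h,\qquad (\Delta_\ell h)_{ij}=\Delta h_{ij}+2R_{ipqj}h^{pq}-R_i^kh_{kj}-R_j^kh_{ik},$$ the linearization at $g$ (in the gauge that makes it elliptic) of the modified Ricci flow $\partial_\tau g=-2\mathrm{Rc}(g)-\mathcal L_Xg-3g$.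 The $L^2$-closure of $L$ is taken from the initial domain of smooth compactly supported symmetric $2$-tensor fields, and norms and pairings $\|\cdot\|$, $(\cdot,\cdot)$ are those of $L^2(\mu)$. Then $(\mathbb R^4,g,X_0,3)$ satisfies the Ricci soliton equation $2\,\mathrm{Rc}+\mathcal L_{X_0}g+3g=0$. Moreover, for $X=X_0$, and also for $X=2X_0$: 1. $L$ is strictly linearly stable: there is $\omega>0$ such that $(\bar Lu,u)\le-\omega\|u\|^2$ for all $u$ in the domain of the $L^2$-closure $\bar L$ of $L$. 2. There is $\omega>0.0057$ such that for all smooth compactly supported symmetric $2$-tensor fields $h$ $$\int\langle Lh,h\rangle\,d\mu\le-\|\nabla h\|^2-\omega\|h\|^2 .$$ -/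

import Mathlib

open MeasureTheory Filter Topology
open scoped ContDiff

/-! Riemannian geometry on `ℝⁿ` with its standard smooth structure, for a Riemannian metric `g`
with a global `g`-orthonormal frame `F`. Traces are taken over `F`, and components of tensors are
components with respect to `F`. -/

namespace SolitonStability

noncomputable section

/-- The underlying manifold `ℝⁿ`. Only its smooth structure and its standard coordinates are used:
all lengths are measured with the metric `g`. -/
abbrev Pt (n : ℕ) : Type := Fin n → ℝ

/-- Vector fields on `ℝⁿ`, in standard coordinates. -/
abbrev VField (n : ℕ) : Type := Pt n → Pt n

/-- A field of bilinear forms on the tangent spaces of `ℝⁿ`. -/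
abbrev BilinField (n : ℕ) : Type := Pt n → (Pt n →L[ℝ] Pt n →L[ℝ] ℝ)

/-- A covariant `2`-tensor field, viewed as a map that sends two vector fields to a function. -/
abbrev Tensor2 (n : ℕ) : Type := VField n → VField n → Pt n → ℝ

/-- A Riemannian metric, as a family of inner products. -/
abbrev RMetric (n : ℕ) : Type := Pt n → Pt n → Pt n → ℝ

variable {n : ℕ}

/-- The derivative `V f` of a function along a vector field. -/
def dirDeriv (V : VField n) (f : Pt n → ℝ) : Pt n → ℝ := fun x => fderiv ℝ f x (V x)

/-- The Lie bracket `[V, W]`, with `[V, W] f = V (W f) - W (V f)`. -/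
def bracket (V W : VField n) : VField n := VectorField.lieBracket ℝ V W

/-- The metric as a `2`-tensor field: `⟨V, W⟩`. -/
def RMetric.pair (g : RMetric n) : Tensor2 n := fun V W x => g x (V x) (W x)

/-- A field of bilinear forms as a `2`-tensor field: `h(V, W)`. -/
def BilinField.toTensor (h : BilinField n) : Tensor2 n := fun V W x => h x (V x) (W x)

/-- `⟨∇_V W, Z⟩` for the Levi-Civita connection `∇` of `g`, by the Koszul formula. -/
def koszul (g : RMetric n) (V W Z : VField n) : Pt n → ℝ := fun x =>
  (1 / 2) * (dirDeriv V (g.pair W Z) x + dirDeriv W (g.pair V Z) x - dirDeriv Z (g.pair V W) x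
    + g.pair (bracket V W) Z x - g.pair (bracket V Z) W x - g.pair (bracket W Z) V x)

/-- The Levi-Civita connection `∇_V W = ∑ₐ ⟨∇_V W, Fₐ⟩ Fₐ`, for a `g`-orthonormal frame `F`. -/
def nabla (g : RMetric n) (F : Fin n → VField n) (V W : VField n) : VField n := fun x =>
  ∑ a, koszul g V W (F a) x • F a x

/-- The curvature `R(V, W) Z = ∇_V ∇_W Z - ∇_W ∇_V Z - ∇_[V,W] Z`. -/
def curv (g : RMetric n) (F : Fin n → VField n) (V W Z : VField n) : VField n :=
  nabla g F V (nabla g F W Z) - nabla g F W (nabla g F V Z) - nabla g F (bracket V W) Z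

/-- The curvature tensor `⟨R(V, W) Z, T⟩`, so that `⟨R(V, W) W, V⟩` is the sectional curvature of
the plane of an orthonormal pair `V, W`. -/
def riem (g : RMetric n) (F : Fin n → VField n) (V W Z T : VField n) : Pt n → ℝ :=
  g.pair (curv g F V W Z) T

/-- The Ricci tensor `Rc(Y, Z) = tr (V ↦ R(V, Y) Z)`. -/
def ricci (g : RMetric n) (F : Fin n → VField n) : Tensor2 n := fun Y Z x =>
  ∑ a, riem g F (F a) Y Z (F a) x

/-- The covariant derivative `∇_V T` of a `2`-tensor field. -/
def nablaT (g : RMetric n) (F : Fin n → VField n) (V : VField n) (T : Tensor2 n) : Tensor2 n :=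
  fun Y Z x => dirDeriv V (T Y Z) x - T (nabla g F V Y) Z x - T Y (nabla g F V Z) x

/-- The rough Laplacian `Δ T = ∑ₐ ∇²T(Fₐ, Fₐ)`, with
`∇²T(V, V) = ∇_V ∇_V T - ∇_{∇_V V} T`. -/
def roughLaplacian (g : RMetric n) (F : Fin n → VField n) (T : Tensor2 n) : Tensor2 n :=
  fun Y Z x => ∑ a, (nablaT g F (F a) (nablaT g F (F a) T) Y Z x
    - nablaT g F (nabla g F (F a) (F a)) T Y Z x)

/-- The Lichnerowicz Laplacian
`(Δ_ℓ T)_{ij} = (Δ T)_{ij} + 2 R_{ipqj} T^{pq} - R_i^k T_{kj} - R_j^k T_{ik}`. -/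
def lichnerowicz (g : RMetric n) (F : Fin n → VField n) (T : Tensor2 n) : Tensor2 n :=
  fun Y Z x => roughLaplacian g F T Y Z x
    + 2 * ∑ p, ∑ q, riem g F Y (F p) (F q) Z x * T (F p) (F q) x
    - ∑ k, ricci g F Y (F k) x * T (F k) Z x
    - ∑ k, ricci g F Z (F k) x * T Y (F k) x

/-- The Lie derivative `ℒ_X T` of a `2`-tensor field. -/
def lieDerivT (X : VField n) (T : Tensor2 n) : Tensor2 n := fun Y Z x =>
  dirDeriv X (T Y Z) x - T (bracket X Y) Z x - T Y (bracket X Z) x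

/-- The linearization `L h = Δ_ℓ h - ℒ_X h - α h` of the modified Ricci flow
`∂g/∂τ = -2 Rc(g) - ℒ_X g - α g` at `g` (in the gauge that makes it elliptic). -/
def linOp (g : RMetric n) (F : Fin n → VField n) (X : VField n) (α : ℝ) (T : Tensor2 n) :
    Tensor2 n := fun Y Z x =>
  lichnerowicz g F T Y Z x - lieDerivT X T Y Z x - α * T Y Z x

/-- The Ricci soliton equation `2 Rc + α g + ℒ_X g = 0`, as an identity between the components
with respect to the frame. -/
def SolitonEquation (g : RMetric n) (F : Fin n → VField n) (X : VField n) (α : ℝ) : Prop :=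
  ∀ i j x, 2 * ricci g F (F i) (F j) x + α * g.pair (F i) (F j) x
    + lieDerivT X g.pair (F i) (F j) x = 0

/-- The Riemannian measure `dμ = √det(g_{ij}) dx₁ ⋯ dxₙ`. -/
def riemVolume (g : RMetric n) : Measure (Pt n) :=
  volume.withDensity fun x => ENNReal.ofReal
    (Real.sqrt (Matrix.det (Matrix.of fun i j : Fin n => g x (Pi.single i 1) (Pi.single j 1))))

/-- The pointwise inner product `⟨S, T⟩` of two `2`-tensor fields. -/
def innerT (F : Fin n → VField n) (S T : Tensor2 n) : Pt n → ℝ := fun x =>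
  ∑ i, ∑ j, S (F i) (F j) x * T (F i) (F j) x

/-- The pointwise square norm `|∇T|²` of the covariant derivative of a `2`-tensor field. -/
def gradNormSq (g : RMetric n) (F : Fin n → VField n) (T : Tensor2 n) : Pt n → ℝ := fun x =>
  ∑ a, innerT F (nablaT g F (F a) T) (nablaT g F (F a) T) x

/-- Smooth compactly supported symmetric covariant `2`-tensor fields (variations of metrics). -/
structure IsTestTensor (h : BilinField n) : Prop where
  smooth : ContDiff ℝ ∞ h
  compact : HasCompactSupport h
  symm : ∀ x v w, h x v w = h x w v

/-- The pair `(u, f)` of square integrable `2`-tensor fields, given by their components in the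
orthonormal frame, lies in the graph of the `L²`-closure of `L`, where `L` has as its initial
domain the smooth compactly supported symmetric `2`-tensor fields. -/
def InGraphClosure (g : RMetric n) (F : Fin n → VField n) (X : VField n) (α : ℝ)
    (u f : Fin n → Fin n → Pt n → ℝ) : Prop :=
  (∀ i j, MemLp (u i j) 2 (riemVolume g) ∧ MemLp (f i j) 2 (riemVolume g)) ∧
  ∃ h : ℕ → BilinField n, (∀ k, IsTestTensor (h k)) ∧ ∀ i j,
    Tendsto (fun k => eLpNorm (fun x => (h k).toTensor (F i) (F j) x - u i j x) 2 (riemVolume g))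
      atTop (𝓝 0) ∧
    Tendsto (fun k => eLpNorm
      (fun x => linOp g F X α (h k).toTensor (F i) (F j) x - f i j x) 2 (riemVolume g))
      atTop (𝓝 0)

/-- Strict linear stability: on the domain of the `L²`-closure of `L`, the quadratic form of the
operator satisfies `(L u, u) ≤ -κ ‖u‖²` for some `κ > 0`. -/
def StrictlyLinearlyStable (g : RMetric n) (F : Fin n → VField n) (X : VField n) (α : ℝ) : Prop :=
  ∃ κ : ℝ, 0 < κ ∧ ∀ u f : Fin n → Fin n → Pt n → ℝ, InGraphClosure g F X α u f →
    (∫ x, ∑ i, ∑ j, f i j x * u i j x ∂(riemVolume g))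
      ≤ -κ * (∫ x, ∑ i, ∑ j, u i j x ^ 2 ∂(riemVolume g))

/-- The frame `F₁ = ∂₁`, `F₂ = ∂₂`, `F₃ = ∂₃`, `F₄ = x₁ ∂₂ + x₂ ∂₃ + ∂₄` on `ℝ⁴`
(indices start at `0` in the code). -/
def nilFrame : Fin 4 → VField 4 :=
  ![fun _ => ![1, 0, 0, 0], fun _ => ![0, 1, 0, 0], fun _ => ![0, 0, 1, 0],
    fun x => ![0, x 0, x 1, 1]]

/-- The dual coframe `φ¹ = dx₁`, `φ² = dx₂ - x₁ dx₄`, `φ³ = dx₃ - x₂ dx₄`, `φ⁴ = dx₄`. -/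
def nilCoframe : Fin 4 → Pt 4 → Pt 4 → ℝ :=
  ![fun _ v => v 0, fun x v => v 1 - x 0 * v 3, fun x v => v 2 - x 1 * v 3, fun _ v => v 3]

/-- The metric `g = φ¹ ⊗ φ¹ + φ² ⊗ φ² + φ³ ⊗ φ³ + φ⁴ ⊗ φ⁴`. -/
def nilMetric : RMetric 4 := fun x v w => ∑ a, nilCoframe a x v * nilCoframe a x w

/-- The soliton field `X = -x₁ ∂₁ - (3/2) x₂ ∂₂ - 2 x₃ ∂₃ - (1/2) x₄ ∂₄`. -/
def nilX : VField 4 := fun x => ![-x 0, -(3 / 2) * x 1, -2 * x 2, -(1 / 2) * x 3]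

/-- The frame is orthonormal. -/
theorem nilFrame_orthonormal (i j : Fin 4) (x : Pt 4) :
    nilMetric.pair (nilFrame i) (nilFrame j) x = if i = j then 1 else 0 := by
  fin_cases i <;> fin_cases j <;>
    simp [RMetric.pair, nilMetric, nilCoframe, nilFrame, Fin.sum_univ_four]

end

end SolitonStability

/-!
The frame `F₁, …, F₄` generates a nilpotent group with brackets `[F₁, F₄] = F₂`, `[F₂, F₄] = F₃`, and
`g` is left-invariant, so the connection, the curvature and the Ricci tensor have constant frame
components; the Koszul formula gives them explicitly (`nabla_leftInv`, `curv_leftInv`,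
`ricci_nilFrame`). The field `X` acts as a grading derivation: `[X, Fᵢ] = wᵢ Fᵢ` with
`w = (1, 3/2, 2, 1/2)`. Since `Rc` is diagonal, the soliton equation is the identity
`2 Rcᵢᵢ + 3 - 2 wᵢ = 0`.

Stability is a statement about the zeroth order part of `L`. The frame is divergence free and the
connection is metric, so `∫⟨Δh, h⟩ = -‖∇h‖²`. In the frame, `ℒ_{sX} h` has the components
`s (X hᵢⱼ - (wᵢ + wⱼ) hᵢⱼ)`, and `div X = -5` turns `∫ (X hᵢⱼ) hᵢⱼ` into `(5/2) ∫ hᵢⱼ²`. Hence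
`∫⟨Lh, h⟩ = -‖∇h‖² + ∫ Q_s(h)` exactly, for the constant coefficient quadratic form `Q_s` on symmetric
`4 × 4` matrices given by `zerothForm`, made of the curvature, the weights `wᵢ` and the constant
`3`. For `s = 1` and `s = 2` this form is at most `-(1/10) |h|²` (`zerothForm_le`), which is a
completion of squares. This gives the energy estimate for test tensors (`integral_linOp_le`), and
strict linear stability on the domain of the `L²`-closure follows by continuity of the `L²`
pairing.
-/

namespace SolitonStability

noncomputable section

/-! ### Left-invariant vector fields on the nilpotent group -/

/-- The left-invariant vector field `∑ᵢ cᵢ Fᵢ` with constant frame components `c`. -/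
def leftInv (c : Fin 4 → ℝ) : VField 4 := fun x => ∑ i, c i • nilFrame i x

/-- The Lie bracket of left-invariant fields, in frame components. -/
def brC (b c : Fin 4 → ℝ) : Fin 4 → ℝ :=
  ![0, b 0 * c 3 - b 3 * c 0, b 1 * c 3 - b 3 * c 1, 0]

/-- The Levi-Civita connection on left-invariant fields, in frame components. -/
def connC (b c : Fin 4 → ℝ) : Fin 4 → ℝ :=
  ![(b 1 * c 3 + b 3 * c 1) / 2, (b 0 * c 3 + b 2 * c 3 - b 3 * c 0 + b 3 * c 2) / 2,
    (b 1 * c 3 - b 3 * c 1) / 2, -(b 0 * c 1 + b 1 * c 0 + b 1 * c 2 + b 2 * c 1) / 2]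

theorem leftInv_eq (c : Fin 4 → ℝ) :
    leftInv c = fun x => ![c 0, c 1 + c 3 * x 0, c 2 + c 3 * x 1, c 3] := by
  funext x i
  fin_cases i <;> simp [leftInv, nilFrame, Fin.sum_univ_four]

theorem nilFrame_eq_leftInv (i : Fin 4) : nilFrame i = leftInv (Pi.single i 1) := by
  funext x
  simp [leftInv, Pi.single_apply]

theorem leftInv_sub (b c : Fin 4 → ℝ) : leftInv (b - c) = leftInv b - leftInv c := by
  funext x
  simp [leftInv, sub_smul, Finset.sum_sub_distrib]

theorem pair_leftInv (b c : Fin 4 → ℝ) :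
    nilMetric.pair (leftInv b) (leftInv c) = fun _ => ∑ i, b i * c i := by
  funext x
  simp [RMetric.pair, nilMetric, nilCoframe, leftInv_eq, Fin.sum_univ_four]
  ring

/-- The coordinate `xₖ`, as a linear form. -/
def coordL (k : Fin 4) : Pt 4 →L[ℝ] ℝ := ContinuousLinearMap.proj k

@[simp] theorem coordL_apply (k : Fin 4) (v : Pt 4) : coordL k v = v k := rfl

/-- The linear part of the affine vector field `leftInv c`. -/
theorem hasFDerivAt_leftInv (c : Fin 4 → ℝ) (x : Pt 4) :
    HasFDerivAt (leftInv c)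
      (ContinuousLinearMap.pi ![0, c 3 • coordL 0, c 3 • coordL 1, 0]) x := by
  rw [leftInv_eq, hasFDerivAt_pi']
  have h (k : Fin 4) : HasFDerivAt (fun x : Pt 4 => x k) (coordL k) x := (coordL k).hasFDerivAt
  intro i
  fin_cases i
  · exact (hasFDerivAt_const (c 0) x).congr_fderiv (by ext; simp)
  · exact (((h 0).const_mul (c 3)).const_add (c 1)).congr_fderiv (by ext; simp)
  · exact (((h 1).const_mul (c 3)).const_add (c 2)).congr_fderiv (by ext; simp)
  · exact (hasFDerivAt_const (c 3) x).congr_fderiv (by ext; simp)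

/-- `X` is a linear vector field. -/
theorem hasFDerivAt_nilX (x : Pt 4) :
    HasFDerivAt nilX (ContinuousLinearMap.pi ![(-1 : ℝ) • coordL 0, (-(3 / 2) : ℝ) • coordL 1,
      (-2 : ℝ) • coordL 2, (-(1 / 2) : ℝ) • coordL 3]) x := by
  have : nilX = ContinuousLinearMap.pi ![(-1 : ℝ) • coordL 0, (-(3 / 2) : ℝ) • coordL 1,
      (-2 : ℝ) • coordL 2, (-(1 / 2) : ℝ) • coordL 3] := by
    funext y i
    fin_cases i <;> simp [nilX]
  rw [this]
  exact ContinuousLinearMap.hasFDerivAt _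

theorem bracket_leftInv (b c : Fin 4 → ℝ) :
    bracket (leftInv b) (leftInv c) = leftInv (brC b c) := by
  funext x
  rw [bracket, VectorField.lieBracket, (hasFDerivAt_leftInv b x).fderiv,
    (hasFDerivAt_leftInv c x).fderiv]
  funext i
  fin_cases i <;> simp [leftInv_eq, brC] <;> ring

/-- The weights of the grading derivation `ad X`: `[X, Fᵢ] = wᵢ Fᵢ`. -/
def wt : Fin 4 → ℝ := ![1, 3 / 2, 2, 1 / 2]

theorem bracket_smul_nilX (s : ℝ) (i : Fin 4) :
    bracket (s • nilX) (nilFrame i) = leftInv ((s * wt i) • Pi.single i 1) := by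
  funext x
  rw [nilFrame_eq_leftInv, bracket, VectorField.lieBracket, (hasFDerivAt_leftInv _ x).fderiv,
    ((hasFDerivAt_nilX x).const_smul s).fderiv]
  funext j
  fin_cases i <;> fin_cases j <;> simp [leftInv_eq, nilX, wt] <;> ring

theorem dirDeriv_const {n : ℕ} (V : VField n) (r : ℝ) : dirDeriv V (fun _ => r) = fun _ => 0 := by
  funext x
  simp [dirDeriv]

theorem nabla_leftInv (b c : Fin 4 → ℝ) :
    nabla nilMetric nilFrame (leftInv b) (leftInv c) = leftInv (connC b c) := by
  funext x
  have hk (a : Fin 4) :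
      koszul nilMetric (leftInv b) (leftInv c) (nilFrame a) x = connC b c a := by
    rw [nilFrame_eq_leftInv]
    simp only [koszul, pair_leftInv, dirDeriv_const, bracket_leftInv, Fin.sum_univ_four]
    fin_cases a <;> simp [brC, connC] <;> ring
  simp only [nabla, hk, leftInv]

/-- The curvature operator on left-invariant fields, in frame components. -/
def curvC (b c d : Fin 4 → ℝ) : Fin 4 → ℝ :=
  connC b (connC c d) - connC c (connC b d) - connC (brC b c) d

theorem curv_leftInv (b c d : Fin 4 → ℝ) :
    curv nilMetric nilFrame (leftInv b) (leftInv c) (leftInv d) = leftInv (curvC b c d) := by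
  simp only [curv, nabla_leftInv, bracket_leftInv, curvC, leftInv_sub]

theorem riem_nilFrame (i j k l : Fin 4) (x : Pt 4) :
    riem nilMetric nilFrame (nilFrame i) (nilFrame j) (nilFrame k) (nilFrame l) x
      = curvC (Pi.single i 1) (Pi.single j 1) (Pi.single k 1) l := by
  simp [riem, nilFrame_eq_leftInv, curv_leftInv, pair_leftInv, Pi.single_apply]

/-- The eigenvalues of the Ricci tensor, which is diagonal in the frame. -/
def rcC : Fin 4 → ℝ := ![-(1 / 2), 0, 1 / 2, -1]

theorem ricci_nilFrame (i j : Fin 4) (x : Pt 4) :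
    ricci nilMetric nilFrame (nilFrame i) (nilFrame j) x = if i = j then rcC i else 0 := by
  simp only [ricci, riem_nilFrame, Fin.sum_univ_four]
  fin_cases i <;> fin_cases j <;>
    simp [curvC, connC, brC, rcC] <;> norm_num

theorem nil_soliton : SolitonEquation nilMetric nilFrame nilX 3 := by
  intro i j x
  have hX (i : Fin 4) : bracket nilX (nilFrame i) = leftInv (wt i • Pi.single i 1) := by
    simpa using bracket_smul_nilX 1 i
  rw [ricci_nilFrame, nilFrame_orthonormal, lieDerivT, hX, hX]
  simp only [nilFrame_eq_leftInv, pair_leftInv, dirDeriv_const, Fin.sum_univ_four]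
  fin_cases i <;> fin_cases j <;> simp [rcC, wt] <;> norm_num

/-! ### Riemannian measure -/

/-- The coframe is unipotent in the standard coordinates, so the metric has determinant `1`. -/
theorem riemVolume_nilMetric : riemVolume nilMetric = volume := by
  have h (x : Pt 4) : Matrix.det (Matrix.of fun i j : Fin 4 =>
      nilMetric x (Pi.single i 1) (Pi.single j 1)) = 1 := by
    have hc (i j : Fin 4) : nilMetric x (Pi.single i 1) (Pi.single j 1) =
        !![1, 0, 0, 0; 0, 1, 0, -x 0; 0, 0, 1, -x 1; 0, -x 0, -x 1, 1 + x 0 ^ 2 + x 1 ^ 2] i j := by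
      fin_cases i <;> fin_cases j <;> simp [nilMetric, nilCoframe, Fin.sum_univ_four]
      ring
    simp only [hc]
    simp [Matrix.det_succ_row_zero, Fin.sum_univ_succ, Fin.succAbove]
    ring
  simp [riemVolume, h]

/-! ### Test functions and the divergence theorem -/

/-- Smooth compactly supported functions on `ℝⁿ`. -/
structure IsTestFun {n : ℕ} (f : Pt n → ℝ) : Prop where
  smooth : ContDiff ℝ ∞ f
  compact : HasCompactSupport f

namespace IsTestFun

variable {n : ℕ} {f f' : Pt n → ℝ}

theorem zero : IsTestFun (fun _ : Pt n => (0 : ℝ)) := ⟨contDiff_const, HasCompactSupport.zero⟩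

theorem add (hf : IsTestFun f) (hf' : IsTestFun f') : IsTestFun fun x => f x + f' x :=
  ⟨hf.smooth.add hf'.smooth, hf.compact.add hf'.compact⟩

theorem const_mul (r : ℝ) (hf : IsTestFun f) : IsTestFun fun x => r * f x :=
  ⟨contDiff_const.mul hf.smooth, hf.compact.mul_left (f := fun _ => r)⟩

theorem sub (hf : IsTestFun f) (hf' : IsTestFun f') : IsTestFun fun x => f x - f' x := by
  simpa [sub_eq_add_neg] using hf.add (hf'.const_mul (-1))

theorem mul (hf : IsTestFun f) (hf' : IsTestFun f') : IsTestFun fun x => f x * f' x :=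
  ⟨hf.smooth.mul hf'.smooth, hf.compact.mul_right⟩

theorem sum {ι : Type*} [Fintype ι] {f : ι → Pt n → ℝ} (hf : ∀ i, IsTestFun (f i)) :
    IsTestFun fun x => ∑ i, f i x := by
  classical
  have (s : Finset ι) : IsTestFun fun x => ∑ i ∈ s, f i x := by
    induction s using Finset.induction_on with
    | empty => simpa using zero
    | insert a s ha ih => simpa [Finset.sum_insert ha] using (hf a).add ih
  exact this _

theorem dirDeriv {V : VField n} (hV : ContDiff ℝ ∞ V) (hf : IsTestFun f) :
    IsTestFun (dirDeriv V f) := by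
  refine ⟨(hf.smooth.fderiv_right (m := ∞) (by simp)).clm_apply hV, ?_⟩
  refine (hf.compact.fderiv (𝕜 := ℝ)).mono fun x hx => ?_
  contrapose! hx
  simp_all [SolitonStability.dirDeriv]

theorem differentiable (hf : IsTestFun f) : Differentiable ℝ f :=
  hf.smooth.differentiable (by simp)

theorem integrable (hf : IsTestFun f) : Integrable f :=
  hf.smooth.continuous.integrable_of_hasCompactSupport hf.compact

theorem memLp (hf : IsTestFun f) : MemLp f 2 :=
  hf.smooth.continuous.memLp_of_hasCompactSupport hf.compact

/-- The divergence theorem: `∫ V f = -∫ f div V`. -/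
theorem integral_dirDeriv {V : VField n} (hV : ContDiff ℝ ∞ V) (hf : IsTestFun f) :
    ∫ x, SolitonStability.dirDeriv V f x
      = -∫ x, (∑ i, fderiv ℝ V x (Pi.single i 1) i) * f x := by
  have hVi (i : Fin n) : ContDiff ℝ ∞ fun x => V x i := contDiff_pi.1 hV i
  have hd (i : Fin n) (x : Pt n) :
      fderiv ℝ V x (Pi.single i 1) i = fderiv ℝ (fun x => V x i) x (Pi.single i 1) := by
    rw [(hasFDerivAt_pi'.1 (hV.differentiable (by simp) x).hasFDerivAt i).fderiv]
    rfl
  have hcs {p : Pt n → ℝ} {q : Pt n → ℝ} (hp : Continuous p) (hq : IsTestFun q) :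
      Integrable fun x => p x * q x :=
    (hp.mul hq.smooth.continuous).integrable_of_hasCompactSupport hq.compact.mul_left
  have hdf (i : Fin n) : IsTestFun fun x => fderiv ℝ f x (Pi.single i 1) :=
    hf.dirDeriv (V := fun _ => Pi.single i 1) contDiff_const
  have hcV (i : Fin n) : Continuous fun x => fderiv ℝ (fun x => V x i) x (Pi.single i 1) :=
    (((hVi i).fderiv_right (m := ∞) (by simp)).clm_apply contDiff_const).continuous
  have h1 (x : Pt n) : SolitonStability.dirDeriv V f x
      = ∑ i, V x i * fderiv ℝ f x (Pi.single i 1) := by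
    have hx : V x = ∑ i, V x i • (Pi.single i 1 : Pt n) := by
      funext j
      simp [Pi.single_apply]
    rw [SolitonStability.dirDeriv]
    conv_lhs => rw [hx, map_sum]
    simp
  simp only [h1, hd, Finset.sum_mul]
  rw [integral_finsetSum _ fun i _ => hcs (hVi i).continuous (hdf i),
    integral_finsetSum _ fun i _ => hcs (hcV i) hf, ← Finset.sum_neg_distrib]
  refine Finset.sum_congr rfl fun i _ => ?_
  exact integral_mul_fderiv_eq_neg_fderiv_mul_of_integrable (hcs (hcV i) hf)
    (hcs (hVi i).continuous (hdf i)) (hcs (hVi i).continuous hf)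
    (fun x _ => (hVi i).differentiable (by simp) x) (fun x _ => hf.differentiable x)

end IsTestFun

theorem contDiff_nilFrame (i : Fin 4) : ContDiff ℝ ∞ (nilFrame i) := by
  rw [nilFrame_eq_leftInv, leftInv_eq, contDiff_pi]
  intro j
  fin_cases j <;> simp <;> fun_prop

theorem contDiff_nilX : ContDiff ℝ ∞ nilX := by
  rw [contDiff_pi]
  intro j
  fin_cases j <;> simp [nilX] <;> fun_prop

/-- The group is unimodular: the fields of the frame are divergence free. -/
theorem integral_dirDeriv_nilFrame (i : Fin 4) {f : Pt 4 → ℝ} (hf : IsTestFun f) :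
    ∫ x, dirDeriv (nilFrame i) f x = 0 := by
  rw [hf.integral_dirDeriv (contDiff_nilFrame i), nilFrame_eq_leftInv]
  simp [(hasFDerivAt_leftInv _ _).fderiv, Fin.sum_univ_four]

/-- `X` has divergence `-5`. -/
theorem integral_dirDeriv_nilX {f : Pt 4 → ℝ} (hf : IsTestFun f) :
    ∫ x, dirDeriv nilX f x = 5 * ∫ x, f x := by
  rw [hf.integral_dirDeriv contDiff_nilX, ← integral_neg, ← integral_const_mul]
  congr 1
  funext x
  simp [(hasFDerivAt_nilX _).fderiv, Fin.sum_univ_four]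
  ring

/-! ### Tensor fields in frame components -/

/-- The components of a `2`-tensor field with respect to the left-invariant frame. -/
abbrev Comps : Type := Fin 4 → Fin 4 → Pt 4 → ℝ

/-- The connection coefficients `Γₐᵢᵏ`, where `∇_{Fₐ} Fᵢ = ∑ₖ Γₐᵢᵏ Fₖ`. -/
def christoffel (a i k : Fin 4) : ℝ := connC (Pi.single a 1) (Pi.single i 1) k

/-- The components of `∇_{Fₐ} T` in terms of those of `T`. -/
def covD (a : Fin 4) (t : Comps) : Comps := fun i j x =>
  dirDeriv (nilFrame a) (t i j) x - ∑ k, christoffel a i k * t k j x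
    - ∑ k, christoffel a j k * t i k x

/-- On left-invariant fields, `T` is bilinear with components `t`. A `Tensor2` need not be linear
over functions; this is the part of tensoriality that evaluating `∇` in the frame requires. -/
def HasComps (T : Tensor2 4) (t : Comps) : Prop :=
  ∀ b c, T (leftInv b) (leftInv c) = fun x => ∑ i, ∑ j, b i * c j * t i j x

theorem HasComps.apply_nilFrame {T : Tensor2 4} {t : Comps} (h : HasComps T t) (i j : Fin 4) :
    T (nilFrame i) (nilFrame j) = t i j := by
  funext x
  simp [nilFrame_eq_leftInv, h _ _, Pi.single_apply]

/-- Metric compatibility of the connection. -/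
theorem christoffel_skew (a i k : Fin 4) : christoffel a i k = -christoffel a k i := by
  fin_cases a <;> fin_cases i <;> fin_cases k <;> simp [christoffel, connC] <;> norm_num

theorem connC_eq_sum (a : Fin 4) (c : Fin 4 → ℝ) :
    connC (Pi.single a 1) c = fun k => ∑ i, c i * christoffel a i k := by
  funext k
  fin_cases a <;> fin_cases k <;> simp [christoffel, connC, Fin.sum_univ_four] <;> ring

/-- The frame consists of geodesic fields. -/
theorem connC_single_self (a : Fin 4) : connC (Pi.single a 1) (Pi.single a 1) = 0 := by
  funext k
  fin_cases a <;> fin_cases k <;> simp [connC]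

theorem dirDeriv_sum {n : ℕ} {ι : Type*} [Fintype ι] (V : VField n) {f : ι → Pt n → ℝ} {x : Pt n}
    (hf : ∀ i, DifferentiableAt ℝ (f i) x) :
    dirDeriv V (fun x => ∑ i, f i x) x = ∑ i, dirDeriv V (f i) x := by
  simp [dirDeriv, fderiv_fun_sum fun i _ => hf i]

theorem dirDeriv_const_mul {n : ℕ} (V : VField n) (r : ℝ) {f : Pt n → ℝ} {x : Pt n}
    (hf : DifferentiableAt ℝ f x) :
    dirDeriv V (fun x => r * f x) x = r * dirDeriv V f x := by
  simp [dirDeriv, fderiv_const_mul hf]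

theorem dirDeriv_mul {n : ℕ} (V : VField n) {f f' : Pt n → ℝ} {x : Pt n}
    (hf : DifferentiableAt ℝ f x) (hf' : DifferentiableAt ℝ f' x) :
    dirDeriv V (fun x => f x * f' x) x = dirDeriv V f x * f' x + f x * dirDeriv V f' x := by
  simp [dirDeriv, fderiv_fun_mul hf hf']
  ring

theorem HasComps.nablaT {T : Tensor2 4} {t : Comps} (h : HasComps T t)
    (ht : ∀ i j, Differentiable ℝ (t i j)) (a : Fin 4) :
    HasComps (nablaT nilMetric nilFrame (nilFrame a) T) (covD a t) := by
  intro b c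
  funext x
  have hd : dirDeriv (nilFrame a) (fun x => ∑ i, ∑ j, b i * c j * t i j x) x
      = ∑ i, ∑ j, b i * c j * dirDeriv (nilFrame a) (t i j) x := by
    rw [dirDeriv_sum _ fun i => DifferentiableAt.fun_sum fun j _ => (ht i j x).const_mul _]
    refine Finset.sum_congr rfl fun i _ => ?_
    rw [dirDeriv_sum _ fun j => (ht i j x).const_mul _]
    exact Finset.sum_congr rfl fun j _ => dirDeriv_const_mul _ _ (ht i j x)
  rw [SolitonStability.nablaT, h b c, hd, nilFrame_eq_leftInv, nabla_leftInv, nabla_leftInv, h, h,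
    ← nilFrame_eq_leftInv]
  simp only [covD, connC_eq_sum, Fin.sum_univ_four]
  ring

theorem HasComps.roughLaplacian {T : Tensor2 4} {t : Comps} (h : HasComps T t)
    (ht : ∀ i j, IsTestFun (t i j)) (htD : ∀ a i j, IsTestFun (covD a t i j)) (i j : Fin 4)
    (x : Pt 4) :
    roughLaplacian nilMetric nilFrame T (nilFrame i) (nilFrame j) x
      = ∑ a, covD a (covD a t) i j x := by
  refine Finset.sum_congr rfl fun a _ => ?_
  have h2 := (h.nablaT (fun i j => (ht i j).differentiable) a).nablaT
    (fun i j => (htD a i j).differentiable) a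
  have h0 : SolitonStability.nablaT nilMetric nilFrame (leftInv 0) T (nilFrame i) (nilFrame j) x
      = 0 := by
    have hz (c : Fin 4 → ℝ) : connC 0 c = 0 := by
      funext k
      fin_cases k <;> simp [connC]
    have hl : leftInv 0 x = 0 := by simp [leftInv]
    rw [SolitonStability.nablaT, nilFrame_eq_leftInv, nilFrame_eq_leftInv, nabla_leftInv,
      nabla_leftInv, hz, hz, h, h, h]
    simp [dirDeriv, hl]
  have hn : nabla nilMetric nilFrame (nilFrame a) (nilFrame a) = leftInv 0 := by
    rw [nilFrame_eq_leftInv, nabla_leftInv, connC_single_self]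
  rw [h2.apply_nilFrame, hn, h0, sub_zero]

theorem isTestFun_covD {t : Comps} (ht : ∀ i j, IsTestFun (t i j)) (a i j : Fin 4) :
    IsTestFun (covD a t i j) :=
  (((ht i j).dirDeriv (contDiff_nilFrame a)).sub
    (IsTestFun.sum fun k => (ht k j).const_mul _)).sub (IsTestFun.sum fun k => (ht i k).const_mul _)

/-- The components of `L h` for the field `s • X`, in terms of the components `t` of `h`. -/
def linC (s : ℝ) (t : Comps) : Comps := fun i j x =>
  ∑ a, covD a (covD a t) i j x
    + 2 * ∑ p, ∑ q, curvC (Pi.single i 1) (Pi.single p 1) (Pi.single q 1) j * t p q x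
    + (s * (wt i + wt j) - rcC i - rcC j - 3) * t i j x - s * dirDeriv nilX (t i j) x

theorem HasComps.linOp {T : Tensor2 4} {t : Comps} (h : HasComps T t)
    (ht : ∀ i j, IsTestFun (t i j)) (s : ℝ) (i j : Fin 4) :
    linOp nilMetric nilFrame (s • nilX) 3 T (nilFrame i) (nilFrame j) = linC s t i j := by
  funext x
  have hB1 : T (leftInv ((s * wt i) • Pi.single i 1)) (nilFrame j) x = s * wt i * t i j x := by
    rw [nilFrame_eq_leftInv, h]
    simp [Pi.single_apply]
  have hB2 : T (nilFrame i) (leftInv ((s * wt j) • Pi.single j 1)) x = s * wt j * t i j x := by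
    rw [nilFrame_eq_leftInv, h]
    simp [Pi.single_apply]
  have hd : dirDeriv (s • nilX) (t i j) x = s * dirDeriv nilX (t i j) x := by simp [dirDeriv]
  rw [SolitonStability.linOp, lichnerowicz, h.roughLaplacian ht (isTestFun_covD ht), lieDerivT,
    bracket_smul_nilX, bracket_smul_nilX, hB1, hB2]
  simp only [riem_nilFrame, ricci_nilFrame, h.apply_nilFrame, linC, ite_mul, zero_mul,
    Finset.sum_ite_eq, Finset.mem_univ, if_true, hd]
  ring

theorem isTestFun_linC {t : Comps} (ht : ∀ i j, IsTestFun (t i j)) (s : ℝ) (i j : Fin 4) :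
    IsTestFun (linC s t i j) :=
  (((IsTestFun.sum fun a => isTestFun_covD (isTestFun_covD ht a) a i j).add
    (IsTestFun.const_mul 2 (IsTestFun.sum fun p => IsTestFun.sum fun q =>
      (ht p q).const_mul _))).add ((ht i j).const_mul _)).sub
    (((ht i j).dirDeriv contDiff_nilX).const_mul s)

theorem hasComps_toTensor (h : BilinField 4) :
    HasComps h.toTensor fun i j => h.toTensor (nilFrame i) (nilFrame j) := by
  intro b c
  funext x
  simp only [BilinField.toTensor, leftInv, map_sum, map_smul, sum_apply, smul_apply, smul_eq_mul,
    Finset.mul_sum, mul_assoc]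
  rw [Finset.sum_comm]
  simp only [mul_left_comm]

theorem IsTestTensor.isTestFun {h : BilinField 4} (hh : IsTestTensor h) (i j : Fin 4) :
    IsTestFun (h.toTensor (nilFrame i) (nilFrame j)) := by
  refine ⟨(hh.smooth.clm_apply (contDiff_nilFrame i)).clm_apply (contDiff_nilFrame j), ?_⟩
  refine hh.compact.mono fun x hx => ?_
  contrapose! hx
  simp_all [BilinField.toTensor]

/-! ### The quadratic form of `L` -/

/-- Metric compatibility, integrated form: `Fₐ ⟨S, T⟩ = ⟨∇ₐ S, T⟩ + ⟨S, ∇ₐ T⟩`. -/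
theorem dirDeriv_inner {s t : Comps} (hs : ∀ i j, IsTestFun (s i j))
    (ht : ∀ i j, IsTestFun (t i j)) (a : Fin 4) (x : Pt 4) :
    dirDeriv (nilFrame a) (fun x => ∑ i, ∑ j, s i j x * t i j x) x
      = ∑ i, ∑ j, covD a s i j x * t i j x + ∑ i, ∑ j, s i j x * covD a t i j x := by
  have hd : dirDeriv (nilFrame a) (fun x => ∑ i, ∑ j, s i j x * t i j x) x
      = ∑ i, ∑ j, (dirDeriv (nilFrame a) (s i j) x * t i j x
        + s i j x * dirDeriv (nilFrame a) (t i j) x) := by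
    rw [dirDeriv_sum _ fun i =>
      (IsTestFun.sum fun j => (hs i j).mul (ht i j)).differentiable x]
    refine Finset.sum_congr rfl fun i _ => ?_
    rw [dirDeriv_sum _ fun j => ((hs i j).mul (ht i j)).differentiable x]
    exact Finset.sum_congr rfl fun j _ =>
      dirDeriv_mul _ ((hs i j).differentiable x) ((ht i j).differentiable x)
  have hdiag (i : Fin 4) : christoffel a i i = 0 := by linarith [christoffel_skew a i i]
  rw [hd]
  simp only [covD, Fin.sum_univ_four, hdiag, christoffel_skew a 1 0, christoffel_skew a 2 0,
    christoffel_skew a 3 0, christoffel_skew a 2 1, christoffel_skew a 3 1, christoffel_skew a 3 2]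
  ring

/-- The zeroth order part of `L`, together with the term `-(5 / 2) s` that the divergence of
`s • X` contributes to the quadratic form, applied to a matrix `m` and paired with it. -/
def zerothForm (s : ℝ) (m : Fin 4 → Fin 4 → ℝ) : ℝ :=
  ∑ i, ∑ j, (2 * ∑ p, ∑ q, curvC (Pi.single i 1) (Pi.single p 1) (Pi.single q 1) j * m p q
    + (s * (wt i + wt j - 5 / 2) - rcC i - rcC j - 3) * m i j) * m i j

/-- The curvature action `m ↦ ∑_{p q} R_{ipqj} m_{pq}` on symmetric matrices. -/
theorem curvature_action {m : Fin 4 → Fin 4 → ℝ} (hm : ∀ i j, m i j = m j i) (i j : Fin 4) :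
    ∑ p, ∑ q, curvC (Pi.single i 1) (Pi.single p 1) (Pi.single q 1) j * m p q =
      !![(m 1 1 - 3 * m 3 3) / 4, -(m 0 1 + m 1 2) / 4, (m 1 1 - m 3 3) / 4,
          (3 * m 0 3 + m 2 3) / 4;
        -(m 0 1 + m 1 2) / 4, (m 0 0 + 2 * m 0 2 + m 2 2 - 2 * m 3 3) / 4, -(m 0 1 + m 1 2) / 4,
          m 1 3 / 2;
        (m 1 1 - m 3 3) / 4, -(m 0 1 + m 1 2) / 4, (m 1 1 + m 3 3) / 4, (m 0 3 - m 2 3) / 4;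
        (3 * m 0 3 + m 2 3) / 4, m 1 3 / 2, (m 0 3 - m 2 3) / 4,
          (-3 * m 0 0 - 2 * m 0 2 - 2 * m 1 1 + m 2 2) / 4] i j := by
  simp only [Fin.sum_univ_four]
  fin_cases i <;> fin_cases j <;>
    simp [curvC, connC, brC, hm 1 0, hm 2 0, hm 3 0, hm 2 1, hm 3 1, hm 3 2] <;> ring

/-- The zeroth order form is negative definite on symmetric matrices. It splits into the blocks
`(m₀₀, m₀₂, m₁₁, m₂₂, m₃₃)`, `(m₀₁, m₁₂)`, `(m₀₃, m₂₃)` and `(m₁₃)`; only the first needs more than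
completing one square. -/
theorem zerothForm_le {s : ℝ} (hs : s = 1 ∨ s = 2) {m : Fin 4 → Fin 4 → ℝ}
    (hm : ∀ i j, m i j = m j i) :
    zerothForm s m ≤ -(1 / 10) * ∑ i, ∑ j, m i j * m i j := by
  simp only [zerothForm, curvature_action hm]
  simp only [Fin.sum_univ_four, hm 1 0, hm 2 0, hm 3 0, hm 2 1, hm 3 1, hm 3 2]
  rcases hs with rfl | rfl
  · simp [rcC, wt]
    -- The first four squares come from an `LDLᵀ` factorization of the `5 × 5` block, shifted by `1 / 10`.
    linarith [sq_nonneg (24 * m 0 0 - 5 * m 1 1 + 15 * m 3 3),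
      sq_nonneg (24 * m 0 2 - 5 * m 1 1 + 5 * m 3 3),
      sq_nonneg (501 * m 1 1 - 120 * m 2 2 + 365 * m 3 3),
      sq_nonneg (84 * m 2 2 - 5 * m 3 3), sq_nonneg (m 3 3),
      sq_nonneg (m 0 1 + m 1 2), sq_nonneg (m 0 1), sq_nonneg (m 1 2),
      sq_nonneg (m 0 3 - m 2 3), sq_nonneg (m 0 3), sq_nonneg (m 2 3), sq_nonneg (m 1 3)]
  · simp [rcC, wt]
    -- The first five squares account for the off-diagonal entries of the `5 × 5` block.
    linarith [sq_nonneg (5 * m 0 0 - m 1 1 + 3 * m 3 3), sq_nonneg (3 * m 0 2 - m 1 1 + m 3 3),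
      sq_nonneg (5 * m 1 1 - 2 * m 2 2 + 6 * m 3 3), sq_nonneg (m 1 1 + m 3 3),
      sq_nonneg (m 2 2 + m 3 3), sq_nonneg (m 0 0), sq_nonneg (m 0 2), sq_nonneg (m 1 1),
      sq_nonneg (m 2 2), sq_nonneg (m 3 3),
      sq_nonneg (m 0 1 + m 1 2), sq_nonneg (m 0 1), sq_nonneg (m 1 2),
      sq_nonneg (m 0 3 - m 2 3), sq_nonneg (m 0 3), sq_nonneg (m 2 3), sq_nonneg (m 1 3)]

/-- Weitzenböck-type identity: up to divergences, `⟨L h, h⟩` is `-|∇h|²` plus a zeroth order form;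
the term `(5 / 2) s |h|²` cancels the divergence of `s • X` after integration. -/
theorem linC_inner_self {t : Comps} (ht : ∀ i j, IsTestFun (t i j)) (s : ℝ) (x : Pt 4) :
    ∑ i, ∑ j, linC s t i j x * t i j x =
      ∑ a, dirDeriv (nilFrame a) (fun x => ∑ i, ∑ j, covD a t i j x * t i j x) x
        - ∑ a, ∑ i, ∑ j, covD a t i j x * covD a t i j x
        - s / 2 * dirDeriv nilX (fun x => ∑ i, ∑ j, t i j x * t i j x) x
        + 5 / 2 * s * ∑ i, ∑ j, t i j x * t i j x + zerothForm s fun i j => t i j x := by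
  have hX : dirDeriv nilX (fun x => ∑ i, ∑ j, t i j x * t i j x) x
      = ∑ i, ∑ j, 2 * (dirDeriv nilX (t i j) x * t i j x) := by
    rw [dirDeriv_sum _ fun i =>
      (IsTestFun.sum fun j => (ht i j).mul (ht i j)).differentiable x]
    refine Finset.sum_congr rfl fun i _ => ?_
    rw [dirDeriv_sum _ fun j => ((ht i j).mul (ht i j)).differentiable x]
    refine Finset.sum_congr rfl fun j _ => ?_
    rw [dirDeriv_mul _ ((ht i j).differentiable x) ((ht i j).differentiable x)]
    ring
  have hF : ∑ a, dirDeriv (nilFrame a) (fun x => ∑ i, ∑ j, covD a t i j x * t i j x) x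
      - ∑ a, ∑ i, ∑ j, covD a t i j x * covD a t i j x
      = ∑ i, ∑ j, (∑ a, covD a (covD a t) i j x) * t i j x := by
    rw [← Finset.sum_sub_distrib]
    simp only [dirDeriv_inner (isTestFun_covD ht _) ht, add_sub_cancel_right, Finset.sum_mul]
    rw [Finset.sum_comm]
    exact Finset.sum_congr rfl fun i _ => Finset.sum_comm
  rw [hF, hX, zerothForm, Finset.mul_sum, Finset.mul_sum, ← Finset.sum_sub_distrib,
    ← Finset.sum_add_distrib, ← Finset.sum_add_distrib]
  refine Finset.sum_congr rfl fun i _ => ?_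
  rw [Finset.mul_sum, Finset.mul_sum, ← Finset.sum_sub_distrib, ← Finset.sum_add_distrib,
    ← Finset.sum_add_distrib]
  refine Finset.sum_congr rfl fun j _ => ?_
  rw [linC]
  ring

/-- Integration of `linC_inner_self`: the divergence terms drop out, except that `div X = -5`
contributes `-(5 / 2) s |h|²`. -/
theorem integral_linC_le {s : ℝ} (hs : s = 1 ∨ s = 2) {t : Comps}
    (ht : ∀ i j, IsTestFun (t i j)) (hsymm : ∀ i j, t i j = t j i) :
    ∫ x, ∑ i, ∑ j, linC s t i j x * t i j x
      ≤ -(∫ x, ∑ a, ∑ i, ∑ j, covD a t i j x * covD a t i j x)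
        - 1 / 10 * ∫ x, ∑ i, ∑ j, t i j x * t i j x := by
  have hN : IsTestFun fun x => ∑ i, ∑ j, t i j x * t i j x :=
    IsTestFun.sum fun i => IsTestFun.sum fun j => (ht i j).mul (ht i j)
  have hD (a : Fin 4) := isTestFun_covD ht a
  have hψ (a : Fin 4) : IsTestFun fun x => ∑ i, ∑ j, covD a t i j x * t i j x :=
    IsTestFun.sum fun i => IsTestFun.sum fun j => (hD a i j).mul (ht i j)
  have hG : IsTestFun fun x => ∑ a, ∑ i, ∑ j, covD a t i j x * covD a t i j x :=
    IsTestFun.sum fun a => IsTestFun.sum fun i => IsTestFun.sum fun j => (hD a i j).mul (hD a i j)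
  have hL : IsTestFun fun x => ∑ i, ∑ j, linC s t i j x * t i j x :=
    IsTestFun.sum fun i => IsTestFun.sum fun j => (isTestFun_linC ht s i j).mul (ht i j)
  have hFψ (a : Fin 4) := (hψ a).dirDeriv (contDiff_nilFrame a)
  have hXN := hN.dirDeriv contDiff_nilX
  have hR := (((IsTestFun.sum hFψ).sub hG).sub (hXN.const_mul (s / 2))).add
    (hN.const_mul (5 / 2 * s - 1 / 10))
  calc ∫ x, ∑ i, ∑ j, linC s t i j x * t i j x
      ≤ ∫ x, (∑ a, dirDeriv (nilFrame a) (fun x => ∑ i, ∑ j, covD a t i j x * t i j x) x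
        - ∑ a, ∑ i, ∑ j, covD a t i j x * covD a t i j x
        - s / 2 * dirDeriv nilX (fun x => ∑ i, ∑ j, t i j x * t i j x) x
        + (5 / 2 * s - 1 / 10) * ∑ i, ∑ j, t i j x * t i j x) := by
        refine integral_mono hL.integrable hR.integrable fun x => ?_
        have := zerothForm_le hs (m := fun i j => t i j x) fun i j => congrFun (hsymm i j) x
        beta_reduce at this ⊢
        rw [linC_inner_self ht]
        linarith
    _ = _ := by
        rw [integral_add (((IsTestFun.sum hFψ).sub hG).sub (hXN.const_mul (s / 2))).integrable
            (hN.const_mul _).integrable,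
          integral_sub ((IsTestFun.sum hFψ).sub hG).integrable (hXN.const_mul (s / 2)).integrable,
          integral_sub (IsTestFun.sum hFψ).integrable hG.integrable,
          integral_finsetSum _ fun a _ => (hFψ a).integrable, integral_const_mul,
          integral_const_mul, integral_dirDeriv_nilX hN]
        simp only [integral_dirDeriv_nilFrame _ (hψ _), Finset.sum_const_zero]
        ring

/-- The energy estimate for test tensors, with constant `1 / 10`. -/
theorem integral_linOp_le {s : ℝ} (hs : s = 1 ∨ s = 2) {h : BilinField 4} (hh : IsTestTensor h) :
    ∫ x, innerT nilFrame (linOp nilMetric nilFrame (s • nilX) 3 h.toTensor) h.toTensor x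
      ≤ -(∫ x, gradNormSq nilMetric nilFrame h.toTensor x)
        - 1 / 10 * ∫ x, innerT nilFrame h.toTensor h.toTensor x := by
  have hc := hasComps_toTensor h
  have ht := hh.isTestFun
  have hD (a : Fin 4) := hc.nablaT (fun i j => (ht i j).differentiable) a
  have := integral_linC_le hs ht fun i j => funext fun x => hh.symm x _ _
  simpa only [gradNormSq, innerT, hc.linOp ht s, (hD _).apply_nilFrame] using this

/-! ### Passage to the `L²`-closure -/

/-- Continuity of the `L²` pairing along sequences. -/
theorem tendsto_integral_mul {α : Type*} [MeasurableSpace α] {μ : Measure α} {a b : ℕ → α → ℝ}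
    {a' b' : α → ℝ} (ha : ∀ k, MemLp (a k) 2 μ) (hb : ∀ k, MemLp (b k) 2 μ) (ha' : MemLp a' 2 μ)
    (hb' : MemLp b' 2 μ) (hta : Tendsto (fun k => eLpNorm (fun x => a k x - a' x) 2 μ) atTop (𝓝 0))
    (htb : Tendsto (fun k => eLpNorm (fun x => b k x - b' x) 2 μ) atTop (𝓝 0)) :
    Tendsto (fun k => ∫ x, a k x * b k x ∂μ) atTop (𝓝 (∫ x, a' x * b' x ∂μ)) := by
  have hA := (Lp.tendsto_Lp_iff_tendsto_eLpNorm'' a ha a' ha').2 hta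
  have hB := (Lp.tendsto_Lp_iff_tendsto_eLpNorm'' b hb b' hb').2 htb
  have key {u v : α → ℝ} (hu : MemLp u 2 μ) (hv : MemLp v 2 μ) :
      inner ℝ (hv.toLp v) (hu.toLp u) = ∫ x, u x * v x ∂μ := by
    rw [L2.inner_def]
    refine integral_congr_ae ?_
    filter_upwards [hu.coeFn_toLp, hv.coeFn_toLp] with x h1 h2
    rw [h1, h2]
    simp
  simpa only [key] using hB.inner (𝕜 := ℝ) hA

/-- The energy estimate without its gradient term passes to limits in the graph norm. -/
theorem strictlyLinearlyStable_smul_nilX {s : ℝ} (hs : s = 1 ∨ s = 2) :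
    StrictlyLinearlyStable nilMetric nilFrame (s • nilX) 3 := by
  refine ⟨1 / 10, by norm_num, fun u f ⟨hmem, h, hh, hlim⟩ => ?_⟩
  rw [riemVolume_nilMetric] at hmem hlim ⊢
  have hL (k : ℕ) (i j : Fin 4) := (hasComps_toTensor (h k)).linOp (hh k).isTestFun s i j
  have ht (k : ℕ) (i j : Fin 4) := (hh k).isTestFun i j
  have htL (k : ℕ) (i j : Fin 4) : IsTestFun
      (linOp nilMetric nilFrame (s • nilX) 3 (h k).toTensor (nilFrame i) (nilFrame j)) := by
    rw [hL]
    exact isTestFun_linC (ht k) s i j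
  have hsum {p q : Fin 4 → Fin 4 → Pt 4 → ℝ} (hpq : ∀ i j, Integrable fun x => p i j x * q i j x) :
      ∫ x, ∑ i, ∑ j, p i j x * q i j x = ∑ i, ∑ j, ∫ x, p i j x * q i j x := by
    rw [integral_finsetSum _ fun i _ => integrable_finsetSum _ fun j _ => hpq i j]
    exact Finset.sum_congr rfl fun i _ => integral_finsetSum _ fun j _ => hpq i j
  have hlim1 : Tendsto (fun k => ∫ x, innerT nilFrame
      (linOp nilMetric nilFrame (s • nilX) 3 (h k).toTensor) (h k).toTensor x) atTop
      (𝓝 (∫ x, ∑ i, ∑ j, f i j x * u i j x)) := by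
    simp only [innerT]
    rw [hsum fun i j => (hmem i j).2.integrable_mul (hmem i j).1]
    simp only [hsum fun i j => ((htL _ i j).mul (ht _ i j)).integrable]
    exact tendsto_finsetSum _ fun i _ => tendsto_finsetSum _ fun j _ =>
      tendsto_integral_mul (fun k => (htL k i j).memLp) (fun k => (ht k i j).memLp)
        (hmem i j).2 (hmem i j).1 (hlim i j).2 (hlim i j).1
  have hlim2 : Tendsto (fun k => ∫ x, innerT nilFrame (h k).toTensor (h k).toTensor x) atTop
      (𝓝 (∫ x, ∑ i, ∑ j, u i j x ^ 2)) := by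
    simp only [innerT, sq]
    rw [hsum fun i j => (hmem i j).1.integrable_mul (hmem i j).1]
    simp only [hsum fun i j => ((ht _ i j).mul (ht _ i j)).integrable]
    exact tendsto_finsetSum _ fun i _ => tendsto_finsetSum _ fun j _ =>
      tendsto_integral_mul (fun k => (ht k i j).memLp) (fun k => (ht k i j).memLp)
        (hmem i j).1 (hmem i j).1 (hlim i j).1 (hlim i j).1
  refine le_of_tendsto_of_tendsto' hlim1 (hlim2.const_mul _) fun k => ?_
  have hgrad : 0 ≤ ∫ x, gradNormSq nilMetric nilFrame (h k).toTensor x :=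
    integral_nonneg fun x => Finset.sum_nonneg fun a _ => Finset.sum_nonneg fun i _ =>
      Finset.sum_nonneg fun j _ => mul_self_nonneg _
  linarith [integral_linOp_le hs (hh k)]

end

end SolitonStability

theorem proposition4p5 :
    SolitonStability.SolitonEquation SolitonStability.nilMetric SolitonStability.nilFrame
      SolitonStability.nilX 3 ∧
    ∀ X : SolitonStability.VField 4,
      X = SolitonStability.nilX ∨ X = (2 : ℝ) • SolitonStability.nilX →
      SolitonStability.StrictlyLinearlyStable SolitonStability.nilMetric
        SolitonStability.nilFrame X 3 ∧
      ∃ κ : ℝ, 0.0057 < κ ∧ ∀ h : SolitonStability.BilinField 4,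
        SolitonStability.IsTestTensor h →
        ∫ x, SolitonStability.innerT SolitonStability.nilFrame
            (SolitonStability.linOp SolitonStability.nilMetric SolitonStability.nilFrame X 3
              h.toTensor) h.toTensor x ∂(SolitonStability.riemVolume SolitonStability.nilMetric)
          ≤ -(∫ x, SolitonStability.gradNormSq SolitonStability.nilMetric SolitonStability.nilFrame
              h.toTensor x ∂(SolitonStability.riemVolume SolitonStability.nilMetric))
            - κ * (∫ x, SolitonStability.innerT SolitonStability.nilFrame h.toTensor h.toTensor x
              ∂(SolitonStability.riemVolume SolitonStability.nilMetric)) := by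
  refine ⟨SolitonStability.nil_soliton, fun X hX => ?_⟩
  obtain ⟨s, hs, rfl⟩ : ∃ s : ℝ, (s = 1 ∨ s = 2) ∧ X = s • SolitonStability.nilX := by
    rcases hX with rfl | rfl
    · exact ⟨1, Or.inl rfl, (one_smul ℝ _).symm⟩
    · exact ⟨2, Or.inr rfl, rfl⟩
  refine ⟨SolitonStability.strictlyLinearlyStable_smul_nilX hs, 1 / 10, by norm_num,
    fun h hh => ?_⟩
  rw [SolitonStability.riemVolume_nilMetric]
  exact SolitonStability.integral_linOp_le hs hh
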